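/- Let $X$ be a contractible, first countable Hausdorff space; here contractible means that there are a point $p\in X$ and a continuous map $h\colon X\times[0,1]\to X$ with $h(x,0)=x$ and $h(x,1)=p$ for all $x\in X$. A subset $S\subseteq X$ is called a nontrivial convergent sequence in $X$ if $S$ is countably infinite and there is a point $x\in S$ such that $S\setminus U$ is finite for every open set $U\subseteq X$ containing $x$. Let $\mathcal S_c(X)$ be the set of all nonempty compact subsets of $X$ that are nontrivial convergent sequences in $X$, with the Vietoris topology, that is, the topology with base consisting of the sets $$\Big\{S\in\mathcal S_c(X) : S\subseteq \bigcup\mathcal U \text{ and } S\cap U\neq\emptyset \text{ for every } U\in\mathcal U\Big\},$$ where $\mathcal U$ runs over the finite families of open subsets of $X$. Then $\mathcal S_c(X)$ is pathwise connected: for all $R,S\in\mathcal S_c(X)$ there is a continuous map $\gamma\colon[0,1]\to\mathcal S_c(X)$ with $\gamma(0)=R$ and $\gamma(1)=S$. Moreover, $\mathcal S_c(X)$ is nonempty whenever $X$ has more than one point. -/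

import Mathlib

open TopologicalSpace

/-- A subset `S` of `X` is a nontrivial convergent sequence if it is countably infinite and it has
a point `x ∈ S` (its limit) all of whose open neighbourhoods contain all but finitely many points
of `S`. -/
def IsNontrivialConvergentSeq {X : Type*} [TopologicalSpace X] (S : Set X) : Prop :=
  S.Countable ∧ S.Infinite ∧ ∃ x ∈ S, ∀ U : Set X, IsOpen U → x ∈ U → (S \ U).Finite

/-- The hyperspace of nontrivial convergent sequences in `X`, as a subset of the hyperspace of
nonempty compact subsets of `X`, which Mathlib equips with the Vietoris topology. (In a Hausdorff
space, the only case that is used, compact subsets are closed.) Its coercion to a type carries the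
subspace topology. -/
def convergentSeqHyperspace (X : Type*) [TopologicalSpace X] : Set (NonemptyCompacts X) :=
  {S | IsNontrivialConvergentSeq (S : Set X)}

open Set Filter Topology unitInterval

/-! A contraction pushes every sequence to `p`, but on the way its points may merge with the limit
and leave a finite set. To prevent this, a second sequence travels along: countably many points on
the track of the limit, converging to the current limit locally uniformly in time, with infinitely
many indices off it at every time (`exists_convergentFamily_along`). This tail is grown out of the
limit beforehand, and at the end only it survives. So every sequence is joined to one at `p` that
can itself be shrunk to `p` (`exists_contractible_tail_joined`). Two such sequences are joined
through their union, each growing out of `p` while the other stays fixed. -/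

/-! ### Convergent families and the paths they trace -/

/-- A family of maps `g i` converging to `c` along the cofinite filter, locally uniformly in the
parameter. -/
structure IsConvergentFamily {ι T X : Type*} [TopologicalSpace T] [TopologicalSpace X]
    (c : T → X) (g : ι → T → X) : Prop where
  continuous_limit : Continuous c
  continuous : ∀ i, Continuous (g i)
  exists_nhds : ∀ t, ∀ U ∈ 𝓝 (c t), ∃ V ∈ 𝓝 t, {i | ∃ s ∈ V, g i s ∉ U}.Finite

namespace IsConvergentFamily

variable {ι κ T T' X : Type*} [TopologicalSpace T] [TopologicalSpace T'] [TopologicalSpace X]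
  {c : T → X} {g : ι → T → X}

theorem comp (h : IsConvergentFamily c g) {φ : T' → T} (hφ : Continuous φ) :
    IsConvergentFamily (fun t => c (φ t)) (fun i t => g i (φ t)) where
  continuous_limit := h.continuous_limit.comp hφ
  continuous i := (h.continuous i).comp hφ
  exists_nhds t U hU := by
    obtain ⟨V, hV, hfin⟩ := h.exists_nhds (φ t) U hU
    refine ⟨φ ⁻¹' V, hφ.continuousAt hV, hfin.subset ?_⟩
    rintro i ⟨s, hs, hsU⟩
    exact ⟨φ s, hs, hsU⟩

theorem sumElim (h : IsConvergentFamily c g) {g' : κ → T → X} (h' : IsConvergentFamily c g') :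
    IsConvergentFamily c (Sum.elim g g') where
  continuous_limit := h.continuous_limit
  continuous i := by
    cases i
    exacts [h.continuous _, h'.continuous _]
  exists_nhds t U hU := by
    obtain ⟨V, hV, hfin⟩ := h.exists_nhds t U hU
    obtain ⟨V', hV', hfin'⟩ := h'.exists_nhds t U hU
    refine ⟨V ∩ V', inter_mem hV hV', ((hfin.image Sum.inl).union (hfin'.image Sum.inr)).subset ?_⟩
    rintro (i | i) ⟨s, hs, hsU⟩
    · exact .inl ⟨i, ⟨s, hs.1, hsU⟩, rfl⟩
    · exact .inr ⟨i, ⟨s, hs.2, hsU⟩, rfl⟩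

theorem tendsto (h : IsConvergentFamily c g) (t : T) :
    Tendsto (fun i => g i t) cofinite (𝓝 (c t)) := by
  intro U hU
  obtain ⟨V, hV, hfin⟩ := h.exists_nhds t U hU
  exact hfin.subset fun i hi => ⟨t, mem_of_mem_nhds hV, hi⟩

theorem isNontrivialConvergentSeq [T2Space X] [Countable ι] (h : IsConvergentFamily c g) {t : T}
    (hinf : {i | g i t ≠ c t}.Infinite) :
    IsNontrivialConvergentSeq (insert (c t) (range fun i => g i t)) := by
  refine ⟨(countable_range _).insert _, fun hfin => hinf ?_, c t, mem_insert _ _, fun U hU hc => ?_⟩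
  · have hF : (range (fun i => g i t) \ {c t}).Finite :=
      hfin.subset (sdiff_subset.trans (subset_insert _ _))
    have hU : (range (fun i => g i t) \ {c t})ᶜ ∈ 𝓝 (c t) :=
      hF.isClosed.isOpen_compl.mem_nhds fun hm => hm.2 rfl
    refine Set.Finite.subset (h.tendsto t hU) fun i hi hi' => ?_
    exact hi' ⟨mem_range_self i, hi⟩
  · have hfin : {i | g i t ∉ U}.Finite := h.tendsto t (hU.mem_nhds hc)
    refine (hfin.image fun i => g i t).subset ?_
    rintro y ⟨rfl | ⟨i, rfl⟩, hy⟩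
    · exact (hy hc).elim
    · exact ⟨i, hy, rfl⟩

/-- The member of the hyperspace of nonempty compact sets traced out by a convergent family. -/
def toNonemptyCompacts (h : IsConvergentFamily c g) (t : T) : NonemptyCompacts X :=
  ⟨⟨insert (c t) (range fun i => g i t), (h.tendsto t).isCompact_insert_range_of_cofinite⟩,
    insert_nonempty _ _⟩

theorem continuous_toNonemptyCompacts (h : IsConvergentFamily c g) :
    Continuous h.toNonemptyCompacts := by
  let := TopologicalSpace.vietoris X
  refine NonemptyCompacts.isEmbedding_coe.continuous_iff.2 (continuous_generateFrom_iff.2 ?_)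
  rintro _ (⟨U, hU, rfl⟩ | ⟨U, hU, rfl⟩)
  · refine isOpen_iff_mem_nhds.2 fun t ht => ?_
    change insert (c t) (range fun i => g i t) ⊆ U at ht
    obtain ⟨V, hV, hfin⟩ :=
      h.exists_nhds t U ((show IsOpen U from hU).mem_nhds (ht (mem_insert _ _)))
    -- Finitely many indices escape the uniform control on `V`; continuity of each one handles
    -- these.
    have hev : ∀ᶠ s in 𝓝 t, ∀ i ∈ {i | ∃ s ∈ V, g i s ∉ U}, g i s ∈ U :=
      (eventually_all_finite hfin).2 fun i _ =>
        (h.continuous i).continuousAt.eventually_mem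
          ((show IsOpen U from hU).mem_nhds (ht (mem_insert_of_mem _ (mem_range_self i))))
    filter_upwards [hV, hev, h.continuous_limit.continuousAt.eventually_mem
      ((show IsOpen U from hU).mem_nhds (ht (mem_insert _ _)))] with s hsV hs hc
    change insert (c s) (range fun i => g i s) ⊆ U
    refine insert_subset hc ?_
    rintro _ ⟨i, rfl⟩
    by_contra hi
    exact hi (hs i ⟨s, hsV, hi⟩)
  · refine isOpen_iff_mem_nhds.2 fun t ht => ?_
    obtain ⟨y, hy, hyU⟩ := ht
    have hyU : U ∈ 𝓝 y := (show IsOpen U from hU).mem_nhds hyU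
    rcases hy with rfl | ⟨i, rfl⟩
    · filter_upwards [h.continuous_limit.continuousAt.eventually_mem hyU] with s hs
      exact ⟨c s, mem_insert _ _, hs⟩
    · filter_upwards [(h.continuous i).continuousAt.eventually_mem hyU] with s hs
      exact ⟨g i s, mem_insert_of_mem _ (mem_range_self i), hs⟩

theorem exists_coe_eq [T2Space X] [Countable ι] (h : IsConvergentFamily c g) {t : T}
    (hinf : {i | g i t ≠ c t}.Infinite) :
    ∃ S : convergentSeqHyperspace X, (S.1 : Set X) = insert (c t) (range fun i => g i t) :=
  ⟨⟨h.toNonemptyCompacts t, h.isNontrivialConvergentSeq hinf⟩, rfl⟩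

theorem joined [T2Space X] [Countable ι] {c : I → X} {g : ι → I → X}
    (h : IsConvergentFamily c g) (hinf : ∀ t, {i | g i t ≠ c t}.Infinite)
    {R S : convergentSeqHyperspace X}
    (hR : (R.1 : Set X) = insert (c 0) (range fun i => g i 0))
    (hS : (S.1 : Set X) = insert (c 1) (range fun i => g i 1)) : Joined R S := by
  refine ⟨⟨⟨fun t => ⟨h.toNonemptyCompacts t, h.isNontrivialConvergentSeq (hinf t)⟩, ?_⟩, ?_, ?_⟩⟩
  · exact h.continuous_toNonemptyCompacts.subtype_mk _
  · exact Subtype.ext (SetLike.coe_injective hR.symm)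
  · exact Subtype.ext (SetLike.coe_injective hS.symm)

end IsConvergentFamily

/-! ### Perturbing the parameter of a path -/

/-- The points `t` and `r` of the unit interval are `ε`-close up to a jump inside a fibre of `γ`. -/
def FiberClose {X : Type*} (γ : ℝ → X) (ε t r : ℝ) : Prop :=
  ∃ s ∈ Icc (0 : ℝ) 1, ∃ s' ∈ Icc (0 : ℝ) 1, |t - s| ≤ ε ∧ γ s = γ s' ∧ |s' - r| ≤ ε

theorem FiberClose.of_abs_le {X : Type*} {γ : ℝ → X} {ε t r : ℝ} (ht : t ∈ Icc (0 : ℝ) 1)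
    (hε : 0 ≤ ε) (h : |t - r| ≤ ε) : FiberClose γ ε t r :=
  ⟨t, ht, t, ht, by simpa using hε, rfl, h⟩

/-- Since `γ` may be stationary after `t₀`, a small shift of the parameter need not move the point.
The shift instead leaps to some `s` at most about `ε` past the stretch of constancy; that stretch
lies in one fibre, so `FiberClose` permits the leap. -/
theorem exists_shift_of_lt {X : Type*} (γ : ℝ → X) {ε t₀ u : ℝ} (hε : 0 < ε) (ht₀ : 0 ≤ t₀)
    (hu : u ≤ 1) (hlt : t₀ < u) (hne : γ u ≠ γ t₀) :
    ∃ d : ℝ → ℝ, Continuous d ∧ MapsTo d (Icc 0 1) (Icc 0 1) ∧ γ (d t₀) ≠ γ t₀ ∧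
      ∀ t ∈ Icc (0 : ℝ) 1, ∀ r ∈ uIcc t (d t), FiberClose γ ε t r := by
  obtain ⟨s, hs₀, hs₁, hs, hconst⟩ : ∃ s, t₀ < s ∧ s ≤ 1 ∧ γ s ≠ γ t₀ ∧
      ∀ r, t₀ ≤ r → r ≤ s - ε → γ r = γ t₀ := by
    set B : Set ℝ := {r | t₀ < r ∧ r ≤ 1 ∧ γ r ≠ γ t₀}
    have hB : B.Nonempty := ⟨u, hlt, hu, hne⟩
    have hbdd : BddBelow B := ⟨t₀, fun r hr => hr.1.le⟩
    obtain ⟨s, hsB, hs⟩ := exists_lt_of_csInf_lt hB (lt_add_of_pos_right (sInf B) hε)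
    refine ⟨s, hsB.1, hsB.2.1, hsB.2.2, fun r hr hrs => ?_⟩
    by_contra hr'
    have hr'' : r ∈ B := ⟨lt_of_le_of_ne hr fun h => hr' (h ▸ rfl), by linarith [hsB.2.1], hr'⟩
    linarith [csInf_le hbdd hr'']
  have hd : ∀ t, max t (s - max 0 (t₀ - t) / ε) ≤ max t s := fun t =>
    max_le_max le_rfl (sub_le_self _ (by positivity))
  -- The shift is `max t s` for `t ≥ t₀`. To the left, the slope `1 / ε` and `s ≤ 1` make it the
  -- identity once `t ≤ t₀ - ε`.
  refine ⟨fun t => max t (s - max 0 (t₀ - t) / ε), by fun_prop, fun t ht => ?_, ?_, ?_⟩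
  · exact ⟨ht.1.trans (le_max_left _ _), (hd t).trans (max_le ht.2 hs₁)⟩
  · simpa [max_eq_right hs₀.le] using hs
  · intro t ht r hr
    rw [uIcc_of_le (le_max_left _ _)] at hr
    have hrs := hr.2.trans (hd t)
    rcases le_total s t with hst | hst
    · rw [max_eq_left hst] at hrs
      rw [le_antisymm hrs hr.1]
      exact .of_abs_le ht hε.le (by simpa using hε.le)
    rw [max_eq_right hst] at hrs
    rcases le_total r (t + ε) with hrt | hrt
    · exact .of_abs_le ht hε.le (abs_le.2 ⟨by linarith, by linarith [hr.1]⟩)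
    have hclose : ∀ x ∈ Icc (0 : ℝ) 1, |t - x| ≤ ε → γ x = γ t₀ → t₀ ≤ s - ε → t₀ ≤ r →
        FiberClose γ ε t r := fun x hx htx hγ hle hr₀ => by
      refine ⟨x, hx, max t₀ (min r (s - ε)), ⟨ht₀.trans (le_max_left _ _), ?_⟩, htx, ?_, ?_⟩
      · exact max_le (by linarith) ((min_le_right _ _).trans (by linarith))
      · rw [hγ, hconst _ (le_max_left _ _) (max_le hle (min_le_right _ _))]
      · rw [max_eq_right (le_min hr₀ hle)]
        rcases min_cases r (s - ε) with ⟨h, h'⟩ | ⟨h, h'⟩ <;> rw [h, abs_le] <;>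
          constructor <;> linarith
    rcases le_total t₀ t with h | h
    · exact hclose t ht (by simpa using hε.le) (hconst t h (by linarith)) (by linarith)
        (h.trans hr.1)
    rcases le_total (t₀ - t) ε with h' | h'
    · by_cases hle : t₀ ≤ s - ε
      · rcases le_total t₀ r with hr₀ | hr₀
        · exact hclose t₀ ⟨ht₀, by linarith⟩ (abs_le.2 ⟨by linarith, by linarith⟩) rfl hle hr₀
        · exact .of_abs_le ht hε.le (abs_le.2 ⟨by linarith, by linarith [hr.1]⟩)
      · refine ⟨t₀, ⟨ht₀, by linarith⟩, t₀, ⟨ht₀, by linarith⟩, abs_le.2 ⟨by linarith, by linarith⟩,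
          rfl, abs_le.2 ⟨by linarith, by linarith⟩⟩
    · have h1 : 1 ≤ (t₀ - t) / ε := (one_le_div hε).2 h'
      have h2 : s - max 0 (t₀ - t) / ε ≤ t := by
        rw [max_eq_right (by linarith)]
        linarith [ht.1]
      have : r ≤ t := hr.2.trans (max_le le_rfl h2)
      linarith

theorem exists_shift {X : Type*} (γ : ℝ → X) {ε t₀ u : ℝ} (hε : 0 < ε)
    (ht₀ : t₀ ∈ Icc (0 : ℝ) 1) (hu : u ∈ Icc (0 : ℝ) 1) (hne : γ u ≠ γ t₀) :
    ∃ d : ℝ → ℝ, Continuous d ∧ MapsTo d (Icc 0 1) (Icc 0 1) ∧ γ (d t₀) ≠ γ t₀ ∧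
      ∀ t ∈ Icc (0 : ℝ) 1, ∀ r ∈ uIcc t (d t), FiberClose γ ε t r := by
  rcases lt_trichotomy t₀ u with h | rfl | h
  · exact exists_shift_of_lt γ hε ht₀.1 hu.2 h hne
  · exact (hne rfl).elim
  have hmem : ∀ x ∈ Icc (0 : ℝ) 1, 1 - x ∈ Icc (0 : ℝ) 1 := fun x hx =>
    ⟨by linarith [hx.2], by linarith [hx.1]⟩
  obtain ⟨d, hd, hmaps, hne', hclose⟩ := exists_shift_of_lt (fun x => γ (1 - x)) hε
    (hmem _ ht₀).1 (hmem _ hu).2 (by linarith : 1 - t₀ < 1 - u) (by simpa using hne)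
  refine ⟨fun t => 1 - d (1 - t), by fun_prop, fun t ht => hmem _ (hmaps (hmem _ ht)),
    by simpa using hne', fun t ht r hr => ?_⟩
  obtain ⟨s, hs, s', hs', h₁, h₂, h₃⟩ := hclose (1 - t) (hmem t ht) (1 - r) (by
    rw [mem_uIcc] at hr ⊢
    rcases hr with hr | hr
    · exact .inr ⟨by linarith, by linarith⟩
    · exact .inl ⟨by linarith, by linarith⟩)
  refine ⟨1 - s, hmem s hs, 1 - s', hmem s' hs', ?_, h₂, ?_⟩
  · rw [abs_sub_comm, show 1 - s - t = 1 - t - s by ring]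
    exact h₁
  · rw [abs_sub_comm, show r - (1 - s') = s' - (1 - r) by ring]
    exact h₃

/-- By compactness, for `s` near `t` the fibre of `γ s` in the unit interval stays close to the
fibre of `γ t`, so a jump inside it is harmless. -/
theorem exists_forall_fiberClose_mem {X : Type*} [TopologicalSpace X] [T2Space X] {γ : ℝ → X}
    (hγ : Continuous γ) (t : ℝ) {U : Set X} (hU : U ∈ 𝓝 (γ t)) :
    ∃ ε > 0, ∀ t' r, |t' - t| < ε → FiberClose γ ε t' r → γ r ∈ U := by
  obtain ⟨O, hOU, hO, htO⟩ := mem_nhds_iff.1 hU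
  have hL : IsCompact (Icc (0 : ℝ) 1 ∩ γ ⁻¹' {γ t}) :=
    isCompact_Icc.inter_right (isClosed_singleton.preimage hγ)
  obtain ⟨δ, hδ, hδO⟩ := hL.exists_thickening_subset_open (hO.preimage hγ) (by
    rintro x ⟨-, hx⟩
    rw [mem_preimage, show γ x = γ t from hx]
    exact htO)
  have hM : IsCompact (γ '' (Icc (0 : ℝ) 1 \
      Metric.thickening (δ / 2) (Icc (0 : ℝ) 1 ∩ γ ⁻¹' {γ t}))) :=
    (isCompact_Icc.diff Metric.isOpen_thickening).image hγ
  have htM : γ t ∉ γ '' (Icc (0 : ℝ) 1 \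
      Metric.thickening (δ / 2) (Icc (0 : ℝ) 1 ∩ γ ⁻¹' {γ t})) := by
    rintro ⟨x, ⟨hx, hx'⟩, hxt⟩
    exact hx' (Metric.self_subset_thickening (half_pos hδ) _ ⟨hx, hxt⟩)
  obtain ⟨η, hη, hηM⟩ := Metric.mem_nhds_iff.1
    (hγ.continuousAt.preimage_mem_nhds (hM.isClosed.isOpen_compl.mem_nhds htM))
  refine ⟨min (η / 2) (δ / 4), by positivity, ?_⟩
  rintro t' r ht' ⟨s, -, s', hs', h₁, h₂, h₃⟩
  have hsM := hηM (show s ∈ Metric.ball t η by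
    rw [Metric.mem_ball, Real.dist_eq]
    have h₄ := abs_sub_le s t' t
    rw [abs_sub_comm s t'] at h₄
    linarith [min_le_left (η / 2) (δ / 4)])
  have hs'L : s' ∈ Metric.thickening (δ / 2) (Icc (0 : ℝ) 1 ∩ γ ⁻¹' {γ t}) := by
    by_contra h
    exact hsM ⟨s', ⟨hs', h⟩, h₂.symm⟩
  obtain ⟨z, hz, hzs⟩ := Metric.mem_thickening_iff.1 hs'L
  refine hOU (hδO (Metric.mem_thickening_iff.2 ⟨z, hz, ?_⟩))
  have h₄ := dist_triangle r s' z
  rw [dist_comm r s', Real.dist_eq s' r] at h₄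
  linarith [min_le_right (η / 2) (δ / 4)]

/-- Along a nonconstant path there are sequences converging to the current point and depending
continuously on the time, which can moreover be contracted to the current point. -/
theorem exists_convergentFamily_along {X : Type*} [TopologicalSpace X] [T2Space X] {γ : ℝ → X}
    (hγ : Continuous γ) (hne : γ 0 ≠ γ 1) :
    ∃ (ι : Type) (_ : Countable ι) (g : ι → I × I → X),
      IsConvergentFamily (fun z : I × I => γ z.1) g ∧ (∀ i t, g i (t, 0) = γ t) ∧
        ∀ t, {i | g i (t, 1) ≠ γ t}.Infinite := by
  have hex : ∀ (n : ℕ) (t₀ : I), ∃ d : ℝ → ℝ, Continuous d ∧ MapsTo d (Icc 0 1) (Icc 0 1) ∧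
      γ (d t₀) ≠ γ t₀ ∧
      ∀ t ∈ Icc (0 : ℝ) 1, ∀ r ∈ uIcc t (d t), FiberClose γ (1 / (n + 1 : ℝ)) t r := by
    intro n t₀
    by_cases h : γ 0 = γ t₀
    · exact exists_shift γ (by positivity) t₀.2 (u := 1) (by simp) fun h' => hne (h.trans h'.symm)
    · exact exists_shift γ (by positivity) t₀.2 (u := 0) (by simp) h
  choose d hd hmaps hdne hclose using hex
  have hcover : ∀ n : ℕ, ∃ F : Finset I, ∀ t : I, ∃ t₀ ∈ F, γ (d n t₀ t) ≠ γ t := by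
    intro n
    obtain ⟨F, -, hF⟩ := isCompact_univ.elim_nhds_subcover
      (fun t₀ : I => {t : I | γ (d n t₀ t) ≠ γ t}) fun t₀ _ =>
        (isOpen_ne_fun (hγ.comp ((hd n t₀).comp continuous_subtype_val))
          (hγ.comp continuous_subtype_val)).mem_nhds (hdne n t₀)
    refine ⟨F, fun t => ?_⟩
    simpa using hF (mem_univ t)
  choose F hF using hcover
  -- Finitely many indices per level `n` give convergence; one point off `γ t` per level gives
  -- infinitude. The second parameter slides from `t` to its shift.
  refine ⟨Σ n, F n, inferInstance,
    fun i z => γ (z.1 + z.2 * (d i.1 i.2 z.1 - z.1)), ⟨by fun_prop, fun i => ?_, ?_⟩, ?_, ?_⟩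
  · have := hd i.1 i.2
    fun_prop
  · rintro ⟨t, l⟩ U hU
    obtain ⟨ε, hε, h⟩ := exists_forall_fiberClose_mem hγ t hU
    obtain ⟨N, hN⟩ := exists_nat_one_div_lt hε
    refine ⟨{z | |(z.1 : ℝ) - t| < ε}, ?_, ?_⟩
    · exact (isOpen_lt (by fun_prop) continuous_const).mem_nhds (by simpa using hε)
    · refine ((finite_lt_nat N).biUnion fun n _ => finite_range (Sigma.mk n)).subset ?_
      rintro ⟨n, t₀⟩ ⟨⟨s, m⟩, hs, hsU⟩
      refine mem_biUnion (show n < N from ?_) (mem_range_self t₀)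
      by_contra hn
      refine hsU (h s _ hs ?_)
      have hr : (s + m * (d n t₀ s - s) : ℝ) ∈ uIcc (s : ℝ) (d n t₀ s) := by
        rw [← segment_eq_uIcc]
        exact ⟨1 - m, m, by linarith [m.2.2], m.2.1, by ring, by simp only [smul_eq_mul]; ring⟩
      obtain ⟨x, hx, x', hx', h₁, h₂, h₃⟩ := hclose n t₀ s s.2 _ hr
      have hle : 1 / (n + 1 : ℝ) ≤ ε := by
        refine le_trans ?_ hN.le
        exact Nat.one_div_le_one_div (not_lt.1 hn)
      exact ⟨x, hx, x', hx', h₁.trans hle, h₂, h₃.trans hle⟩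
  · simp
  · intro t
    choose f hf hfne using fun n => hF n t
    refine infinite_of_injective_forall_mem (f := fun n => (⟨n, f n, hf n⟩ : Σ n, F n))
      (fun m n h => congrArg Sigma.fst h) fun n => ?_
    simpa using hfne n

/-! ### Joining sequences -/

theorem infinite_setOf_sumElim_ne_left {κ ι X : Type*} {a : κ → X} {b : ι → X} {c : X}
    (h : {k | a k ≠ c}.Infinite) : {i | Sum.elim a b i ≠ c}.Infinite :=
  (h.image Sum.inl_injective.injOn).mono (by rintro _ ⟨k, hk, rfl⟩; exact hk)

theorem infinite_setOf_sumElim_ne_right {κ ι X : Type*} {a : κ → X} {b : ι → X} {c : X}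
    (h : {i | b i ≠ c}.Infinite) : {i | Sum.elim a b i ≠ c}.Infinite :=
  (h.image Sum.inr_injective.injOn).mono (by rintro _ ⟨k, hk, rfl⟩; exact hk)

theorem IsConvergentFamily.of_tendsto {κ T X : Type*} [TopologicalSpace T] [TopologicalSpace X]
    {a : κ → X} {c : X} (ha : Tendsto a cofinite (𝓝 c)) :
    IsConvergentFamily (fun _ : T => c) (fun k _ => a k) where
  continuous_limit := continuous_const
  continuous _ := continuous_const
  exists_nhds _ _ hU := ⟨univ, univ_mem,
    Set.Finite.subset (ha hU) fun _ ⟨_, _, h⟩ => h⟩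

theorem IsConvergentFamily.of_continuous_uncurry {κ T X : Type*} [TopologicalSpace T]
    [TopologicalSpace X] {a : κ → X} {c : X} (ha : Tendsto a cofinite (𝓝 c)) {h : T × X → X}
    (hh : Continuous h) : IsConvergentFamily (fun t => h (t, c)) (fun k t => h (t, a k)) where
  continuous_limit := by fun_prop
  continuous _ := by fun_prop
  exists_nhds t U hU := by
    obtain ⟨V, hV, W, hW, hVW⟩ := mem_nhds_prod_iff.1 (hh.continuousAt hU)
    have hfin : {k | a k ∉ W}.Finite := ha hW
    refine ⟨V, hV, hfin.subset ?_⟩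
    rintro k ⟨s, hs, hsU⟩ hk
    exact hsU (hVW ⟨hs, hk⟩)

/-- Points growing out of the limit can be added to a convergent sequence along a path. -/
theorem joined_of_contractible_tail {κ ι X : Type*} [TopologicalSpace X] [T2Space X] [Countable κ]
    [Countable ι] {a : κ → X} {c : X} {w : ι → I → X} (ha : Tendsto a cofinite (𝓝 c))
    (hinf : {k | a k ≠ c}.Infinite) (hw : IsConvergentFamily (fun _ => c) w)
    (hw₀ : ∀ i, w i 0 = c) {R S : convergentSeqHyperspace X}
    (hR : (R.1 : Set X) = insert c (range a))
    (hS : (S.1 : Set X) = insert c (range a ∪ range fun i => w i 1)) : Joined R S := by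
  have hfam := (IsConvergentFamily.of_tendsto (T := I) ha).sumElim hw
  have heq : ∀ t : I, (fun i => Sum.elim (fun k _ => a k) w i t) = Sum.elim a (fun i => w i t) :=
    fun t => by ext (k | i) <;> rfl
  refine hfam.joined (fun t => ?_) ?_ ?_
  · convert infinite_setOf_sumElim_ne_left (b := fun i => w i t) hinf using 4 with i
    exact congrFun (heq t) i
  · rw [heq, hR, Sum.elim_range]
    ext y
    simp only [hw₀, mem_insert_iff, mem_union, mem_range]
    grind
  · rw [heq, hS, Sum.elim_range]

theorem IsNontrivialConvergentSeq.exists_tendsto {X : Type*} [TopologicalSpace X] {R : Set X}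
    (hR : IsNontrivialConvergentSeq R) :
    ∃ x, ∃ a : ↥(R \ {x}) → X, Countable ↥(R \ {x}) ∧ Tendsto a cofinite (𝓝 x) ∧
      {k | a k ≠ x}.Infinite ∧ R = insert x (range a) := by
  obtain ⟨hcount, hinf, x, hx, h⟩ := hR
  refine ⟨x, Subtype.val, (hcount.mono sdiff_subset).to_subtype, fun U hU => ?_, ?_, ?_⟩
  · obtain ⟨O, hOU, hO, hxO⟩ := mem_nhds_iff.1 hU
    refine ((h O hO hxO).preimage Subtype.val_injective.injOn).subset fun k hk => ?_
    exact ⟨k.2.1, fun hkO => hk (hOU hkO)⟩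
  · have := (hinf.sdiff (finite_singleton x)).to_subtype
    convert infinite_univ (α := ↥(R \ {x}))
    exact eq_univ_of_forall fun k => k.2.2
  · rw [Subtype.range_val, insert_sdiff_singleton, insert_eq_of_mem hx]

/-- Contracting the space carries every convergent sequence to one which can itself be contracted
to its limit, the limit being the point to which the space contracts. -/
theorem exists_contractible_tail_joined {X : Type*} [TopologicalSpace X] [T2Space X]
    [PathConnectedSpace X] {p : X}
    (H : (ContinuousMap.id X).Homotopy (ContinuousMap.const X p)) (R : convergentSeqHyperspace X) :
    ∃ (ι : Type) (_ : Countable ι) (w : ι → I → X), IsConvergentFamily (fun _ => p) w ∧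
      (∀ i, w i 0 = p) ∧ {i | w i 1 ≠ p}.Infinite ∧
        ∀ S : convergentSeqHyperspace X, (S.1 : Set X) = insert p (range fun i => w i 1) →
          Joined R S := by
  obtain ⟨x, a, hcount, ha, hinf, hRa⟩ := R.2.exists_tendsto
  obtain ⟨k, hk⟩ := hinf.nonempty
  let α : Path x p := ⟨⟨fun t => H (t, x), by fun_prop⟩, by simp, by simp⟩
  -- The track of `x` may be constant, so a path to `a k ≠ x` is appended. Only the first half of
  -- `γ` is travelled, via `half`.
  let γ : ℝ → X := (α.trans (PathConnectedSpace.somePath p (a k))).extend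
  have hγ : Continuous γ := Path.continuous_extend _
  have hγ₀ : γ 0 = x := Path.extend_zero _
  have hγ₁ : γ 1 = a k := Path.extend_one _
  let half : I → I := fun t => ⟨t / 2, by linarith [t.2.1], by linarith [t.2.2]⟩
  have hhalf : Continuous half := by fun_prop
  have hγ_half : ∀ t, γ (half t) = H (t, x) := fun t => by
    have ht : ((half t : I) : ℝ) ≤ 1 / 2 := by
      change (t / 2 : ℝ) ≤ 1 / 2
      linarith [t.2.2]
    refine (Path.extend_apply _ (half t).2).trans ?_
    rw [Path.trans_apply, dif_pos ht]
    change H (_, x) = _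
    congr 2
    ext
    change 2 * (t / 2 : ℝ) = t
    ring
  obtain ⟨ι, hι, g, hg, hg₀, hginf⟩ := exists_convergentFamily_along hγ (by
    rw [hγ₀, hγ₁]
    exact hk.symm)
  have hγp : γ (half 1) = p := by simp [hγ_half]
  have hmid : IsConvergentFamily (fun t => H (t, x))
      (Sum.elim (fun k t => H (t, a k)) fun i t => g i (half t, 1)) := by
    refine (IsConvergentFamily.of_continuous_uncurry ha H.continuous).sumElim ?_
    simpa only [hγ_half] using hg.comp (φ := fun t => (half t, 1)) (by fun_prop)
  have hmid_inf : ∀ t, {i | Sum.elim (fun k t => H (t, a k)) (fun i t => g i (half t, 1)) i t ≠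
      H (t, x)}.Infinite := fun t => by
    convert infinite_setOf_sumElim_ne_right (a := fun k => H (t, a k)) (hginf (half t))
      using 4 with i
    · cases i <;> rfl
    · exact (hγ_half t).symm
  have heq : ∀ t, (range fun i => Sum.elim (fun k t => H (t, a k)) (fun i t => g i (half t, 1)) i t)
      = (range fun k => H (t, a k)) ∪ range fun i => g i (half t, 1) := fun t => by
    rw [← Sum.elim_range]
    congr 1
    ext (k | i) <;> rfl
  have hhalf₀ : half 0 = 0 := by ext; simp [half]
  obtain ⟨S₀, hS₀⟩ := hmid.exists_coe_eq (hmid_inf 0)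
  refine ⟨ι, hι, fun i l => g i (half 1, l), ?_, fun i => ?_, ?_, fun S hS => ?_⟩
  · simpa only [hγp] using hg.comp (φ := fun l => (half 1, l)) (by fun_prop)
  · exact (hg₀ i _).trans hγp
  · simpa only [hγp] using hginf (half 1)
  -- The tail first grows at `x`; then `H` carries the sequence to `p` while the tail follows the
  -- limit.
  · refine Joined.trans ?_ (hmid.joined hmid_inf hS₀ ?_)
    · refine joined_of_contractible_tail (w := fun i l => g i (0, l)) ha hinf ?_ ?_ hRa ?_
      · simpa only [Icc.coe_zero, hγ₀] using hg.comp (φ := fun l => ((0 : I), l)) (by fun_prop)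
      · intro i
        rw [hg₀, Icc.coe_zero, hγ₀]
      · rw [hS₀, heq]
        simp [hhalf₀]
    · rw [hS, heq]
      ext y
      simp only [H.apply_one, ContinuousMap.const_apply, mem_insert_iff, mem_union, mem_range]
      grind

theorem mainTheorem1 {X : Type*} [TopologicalSpace X] [T2Space X] [FirstCountableTopology X]
    [ContractibleSpace X] :
    (∀ R S : convergentSeqHyperspace X, Joined R S) ∧
      (Nontrivial X → Nonempty (convergentSeqHyperspace X)) := by
  refine ⟨fun R S => ?_, fun _ => ?_⟩
  · obtain ⟨p, ⟨H⟩⟩ := id_nullhomotopic X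
    obtain ⟨ι, _, v, hv, hv₀, hvinf, hRv⟩ := exists_contractible_tail_joined H R
    obtain ⟨κ, _, w, hw, hw₀, hwinf, hSw⟩ := exists_contractible_tail_joined H S
    obtain ⟨A, hA⟩ := hv.exists_coe_eq hvinf
    obtain ⟨B, hB⟩ := hw.exists_coe_eq hwinf
    have hvw := (hv.comp (φ := fun _ : I => 1) continuous_const).sumElim
      (hw.comp (φ := fun _ : I => 1) continuous_const)
    obtain ⟨C, hC⟩ := hvw.exists_coe_eq (t := 0) ((infinite_setOf_sumElim_ne_left
      (b := fun i => w i 1) hvinf).mono (by rintro (i | i) hi <;> exact hi))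
    have hC' : (C.1 : Set X) = insert p ((range fun i => v i 1) ∪ range fun i => w i 1) := by
      rw [hC, ← Sum.elim_range]
      congr 2
      ext (i | i) <;> rfl
    have hAC : Joined A C := joined_of_contractible_tail (hv.tendsto 1) hvinf hw hw₀ hA hC'
    have hBC : Joined B C := joined_of_contractible_tail (hw.tendsto 1) hwinf hv hv₀ hB
      (by rw [hC', union_comm])
    exact (hRv A hA).trans (hAC.trans (hBC.symm.trans (hSw B hB).symm))
  · obtain ⟨x, y, hxy⟩ := exists_pair_ne X
    let γ := PathConnectedSpace.somePath x y
    obtain ⟨ι, _, g, hg, -, hginf⟩ := exists_convergentFamily_along γ.continuous_extend (by simpa)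
    exact (hg.exists_coe_eq (hginf 0)).nonempty
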